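/- Fix a finite $n>0$. Formulas are built from letters $p_0,p_1,\dots$ by $\to,\bot,\Diamond_i$ ($i<n$), with $\Box_i=\neg\Diamond_i\neg$ and the other Boolean connectives as usual abbreviations. A logic is a set of formulas that contains the classical tautologies, $\Diamond_i(p\vee q)\to\Diamond_ip\vee\Diamond_iq$ and $\neg\Diamond_i\bot$ ($i<n$), and is closed under modus ponens, substitution and monotonicity ($\varphi\to\psi\,/\,\Diamond_i\varphi\to\Diamond_i\psi$); $L\vdash\varphi$ means $\varphi\in L$. Put $\Diamond^0\varphi=\varphi$, $\Diamond^{m+1}\varphi=\Diamond^m(\Diamond_0\varphi\vee\dots\vee\Diamond_{n-1}\varphi)$, $\Diamond^{\le m}\varphi=\bigvee_{l\le m}\Diamond^l\varphi$. A logic $L$ is pretransitive if $L\vdash\Diamond^{m+1}p\to\Diamond^{\le m}p$ for some $m\ge 0$; for the least such $m$, write $\Diamond^*\varphi=\Diamond^{\le m}\varphi$ and $\Box^*\varphi=\neg\Diamond^*\neg\varphi$. Let $B_0=\bot$, $B_{i+1}=p_{i+1}\to\Box^*(\Diamond^*p_{i+1}\vee B_i)$, and let $L[h]$ be the smallest logic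 containing $L\cup\{B_h\}$. A $k$-formula is a formula in the letters $p_i$, $i<k$. A logic is $k$-tabular if there are only finitely many $k$-formulas up to equivalence in it. The $k$-canonical frame of $L$ consists of the maximal $L$-consistent sets $x$ of $k$-formulas, with $xR_iy$ iff $\Diamond_i\varphi\in x$ for all $\varphi\in y$. With $R=\bigcup_{i<n}R_i$ and $R^*$ its reflexive transitive closure, the depth of $x$ is the supremum of the cardinalities of chains in the poset of clusters ($R^*\cap (R^*)^{-1}$-classes, ordered by $R^*$) of the frame restricted to $R^*(x)=\{y\mid xR^*y\}$. **Theorem.** Let $L$ be a pretransitive logic and let $h,k<\omega$ be such that $L[h]$ is $k$-tabular. Then for each $i\le h$ there is a $k$-formula $\mathbf B_{i,k}$ such that, for all $x$ in the $k$-canonical frame of $L$, $\mathbf B_{i,k}\in x$ iff the depth of $x$ is at most $i$. Moreover, for any such formulas $\mathbf B_{0,k},\dots,\mathbf B_{h,k}$ and every $k$-formula $\varphi$, $$L[h+1]\vdash\varphi\quad\Longleftrightarrow\quad L\vdash\bigwedge_{i\le h}\bigl(\Box^*(\Box^*\varphi\to\mathbf B_{i,k})\to\mathbf B_{i,k}\bigr).$$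 -/

import Mathlib

/-- `n`-modal formulas over the proposition letters `p_0, p_1, …`. -/
inductive Formula (n : ℕ) : Type
  | var : ℕ → Formula n
  | bot : Formula n
  | imp : Formula n → Formula n → Formula n
  | dia : Fin n → Formula n → Formula n

namespace Formula

variable {n : ℕ}

def neg (φ : Formula n) : Formula n := imp φ bot

def or (φ ψ : Formula n) : Formula n := imp (neg φ) ψ

def and (φ ψ : Formula n) : Formula n := neg (imp φ (neg ψ))

def iff (φ ψ : Formula n) : Formula n := and (imp φ ψ) (imp ψ φ)

/-- Finite disjunction; the empty disjunction is `⊥`. -/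
def bigOr (l : List (Formula n)) : Formula n := l.foldr or bot

/-- Finite conjunction; the empty conjunction is `⊤ = ¬⊥`. -/
def bigAnd (l : List (Formula n)) : Formula n := l.foldr and (neg bot)

/-- Uniform substitution of formulas for proposition letters. -/
def subst (s : ℕ → Formula n) : Formula n → Formula n
  | var p => s p
  | bot => bot
  | imp φ ψ => imp (subst s φ) (subst s ψ)
  | dia i φ => dia i (subst s φ)

/-- Classical truth value, the letters and the formulas `◇_i φ` being treated as atoms
whose truth values are given by `v`. -/
def eval (v : Formula n → Prop) : Formula n → Prop
  | var p => v (var p)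
  | bot => False
  | imp φ ψ => eval v φ → eval v ψ
  | dia i φ => v (dia i φ)

/-- Classical tautologies (in the modal language). -/
def IsTautology (φ : Formula n) : Prop := ∀ v : Formula n → Prop, eval v φ

/-- `k`-formulas: all proposition letters are among `p_0, …, p_{k-1}`. -/
def IsKFormula (k : ℕ) : Formula n → Prop
  | var p => p < k
  | bot => True
  | imp φ ψ => IsKFormula k φ ∧ IsKFormula k ψ
  | dia _ φ => IsKFormula k φ

/-- `◇_0 φ ∨ … ∨ ◇_{n-1} φ`. -/
def diaAny (φ : Formula n) : Formula n := bigOr ((List.finRange n).map fun i => dia i φ)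

/-- `◇^0 φ = φ`, `◇^{m+1} φ = ◇^m (◇_0 φ ∨ … ∨ ◇_{n-1} φ)`. -/
def diaPow : ℕ → Formula n → Formula n
  | 0, φ => φ
  | m + 1, φ => diaPow m (diaAny φ)

/-- `◇^{≤m} φ = ⋁_{l ≤ m} ◇^l φ`. -/
def diaLe (m : ℕ) (φ : Formula n) : Formula n :=
  bigOr ((List.range (m + 1)).map fun l => diaPow l φ)

/-- `□^{≤m} φ = ¬ ◇^{≤m} ¬ φ`. -/
def boxLe (m : ℕ) (φ : Formula n) : Formula n := neg (diaLe m (neg φ))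

end Formula

/-- Propositional normal `n`-modal logics. -/
structure IsLogic {n : ℕ} (L : Set (Formula n)) : Prop where
  taut : ∀ φ : Formula n, φ.IsTautology → φ ∈ L
  dia_or : ∀ i : Fin n,
    Formula.imp (.dia i (.or (.var 0) (.var 1))) (.or (.dia i (.var 0)) (.dia i (.var 1))) ∈ L
  dia_bot : ∀ i : Fin n, Formula.neg (.dia i .bot) ∈ L
  mp : ∀ φ ψ : Formula n, Formula.imp φ ψ ∈ L → φ ∈ L → ψ ∈ L
  subst : ∀ (s : ℕ → Formula n) (φ : Formula n), φ ∈ L → φ.subst s ∈ L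
  mono : ∀ (i : Fin n) (φ ψ : Formula n),
    Formula.imp φ ψ ∈ L → Formula.imp (.dia i φ) (.dia i ψ) ∈ L

namespace ModalLogic

variable {n : ℕ}

/-- `L + Ψ`: the smallest logic containing `L ∪ Ψ`. -/
def extendBy (L Ψ : Set (Formula n)) : Set (Formula n) := ⋂₀ {L' | IsLogic L' ∧ L ∪ Ψ ⊆ L'}

theorem isLogic_extendBy (L Ψ : Set (Formula n)) : IsLogic (extendBy L Ψ) where
  taut φ h := fun _ hL' => hL'.1.taut φ h
  dia_or i := fun _ hL' => hL'.1.dia_or i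
  dia_bot i := fun _ hL' => hL'.1.dia_bot i
  mp φ ψ h₁ h₂ := fun L' hL' => hL'.1.mp φ ψ (h₁ L' hL') (h₂ L' hL')
  subst s φ h := fun L' hL' => hL'.1.subst s φ (h L' hL')
  mono i φ ψ h := fun L' hL' => hL'.1.mono i φ ψ (h L' hL')

/-- `L` is `m`-transitive: `L ⊢ ◇^{m+1} p → ◇^{≤m} p`. -/
def IsMTransitive (L : Set (Formula n)) (m : ℕ) : Prop :=
  Formula.imp (.diaPow (m + 1) (.var 0)) (.diaLe m (.var 0)) ∈ L

def IsPretransitive (L : Set (Formula n)) : Prop := ∃ m, IsMTransitive L m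

/-- The least `m` such that `L` is `m`-transitive (meaningful for pretransitive `L`). -/
noncomputable def transIndex (L : Set (Formula n)) : ℕ := sInf {m | IsMTransitive L m}

/-- `◇* φ`, with respect to the pretransitive logic `L`. -/
noncomputable def diaStar (L : Set (Formula n)) (φ : Formula n) : Formula n :=
  .diaLe (transIndex L) φ

/-- `□* φ`, with respect to the pretransitive logic `L`. -/
noncomputable def boxStar (L : Set (Formula n)) (φ : Formula n) : Formula n :=
  .boxLe (transIndex L) φ

/-- `B_0 = ⊥`, `B_{i+1} = p_{i+1} → □*(◇* p_{i+1} ∨ B_i)`. -/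
noncomputable def heightFormula (L : Set (Formula n)) : ℕ → Formula n
  | 0 => .bot
  | i + 1 => .imp (.var (i + 1))
      (boxStar L (.or (diaStar L (.var (i + 1))) (heightFormula L i)))

/-- `L[h] = L + B_h`. -/
noncomputable def ofHeight (L : Set (Formula n)) (h : ℕ) : Set (Formula n) :=
  extendBy L {heightFormula L h}

/-- `L` is `k`-tabular: up to equivalence in `L` there are only finitely many `k`-formulas. -/
def IsKTabular (L : Set (Formula n)) (k : ℕ) : Prop :=
  ∃ S : Set (Formula n), S.Finite ∧ (∀ ψ ∈ S, ψ.IsKFormula k) ∧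
    ∀ φ : Formula n, φ.IsKFormula k → ∃ ψ ∈ S, Formula.iff φ ψ ∈ L

/-- `Γ` is `L`-consistent: no finite conjunction of its members is refutable in `L`. -/
def IsConsistentSet (L Γ : Set (Formula n)) : Prop :=
  ∀ l : List (Formula n), (∀ ψ ∈ l, ψ ∈ Γ) → Formula.neg (.bigAnd l) ∉ L

/-- Maximal `L`-consistent sets of `k`-formulas. -/
def IsMaxConsistent (L : Set (Formula n)) (k : ℕ) (x : Set (Formula n)) : Prop :=
  Maximal (fun Γ : Set (Formula n) => (∀ ψ ∈ Γ, ψ.IsKFormula k) ∧ IsConsistentSet L Γ) x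

end ModalLogic

/-- Kripke frames with `n` relations. The domain may be empty, so that the canonical frame
makes sense for the inconsistent logic too. -/
structure KripkeFrame (n : ℕ) where
  W : Type
  R : Fin n → W → W → Prop

namespace KripkeFrame

variable {n : ℕ}

/-- `R_F = ⋃_i R_i`. -/
def rel (F : KripkeFrame n) (x y : F.W) : Prop := ∃ i, F.R i x y

/-- `R_F^*`, the reflexive transitive closure of `R_F`. -/
def relStar (F : KripkeFrame n) : F.W → F.W → Prop := Relation.ReflTransGen F.rel

/-- The preorder `(W, R_F^*)`. -/
abbrev toPreorder (F : KripkeFrame n) : Preorder F.W where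
  le := F.relStar
  le_refl _ := Relation.ReflTransGen.refl
  le_trans _ _ _ := Relation.ReflTransGen.trans

/-- The restriction of `F` onto `V`. -/
def restrict (F : KripkeFrame n) (V : Set F.W) : KripkeFrame n where
  W := V
  R i x y := F.R i x y

/-- The restriction of `F` onto `R_F^*(x)`. -/
def cone (F : KripkeFrame n) (x : F.W) : KripkeFrame n := F.restrict {y | F.relStar x y}

/-- The height of `F`: the supremum in `ℕ∞` of the cardinalities of the chains in the skeleton
of `F`, i.e. in the poset of clusters of `F`. -/
noncomputable def height (F : KripkeFrame n) : ℕ∞ :=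
  letI : Preorder F.W := F.toPreorder
  (Set.univ : Set (Antisymmetrization F.W (· ≤ ·))).chainHeight (· ≤ ·)

/-- The depth of `x` in `F`. -/
noncomputable def depth (F : KripkeFrame n) (x : F.W) : ℕ∞ := (F.cone x).height

end KripkeFrame

namespace ModalLogic

variable {n : ℕ}

/-- The `k`-canonical frame of `L`. -/
def canonicalFrame (L : Set (Formula n)) (k : ℕ) : KripkeFrame n where
  W := {x : Set (Formula n) // IsMaxConsistent L k x}
  R i x y := ∀ φ, φ ∈ y.1 → Formula.dia i φ ∈ x.1

/-- `B 0, …, B h` are `k`-formulas `B_{0,k}, …, B_{h,k}` defining depth in the `k`-canonical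
frame of `L`: `B_{i,k} ∈ x` iff the depth of `x` is at most `i`. -/
def DefinesDepth (L : Set (Formula n)) (h k : ℕ) (B : ℕ → Formula n) : Prop :=
  ∀ i ≤ h, (B i).IsKFormula k ∧
    ∀ x : (canonicalFrame L k).W, B i ∈ x.1 ↔ (canonicalFrame L k).depth x ≤ (i : ℕ∞)

/-- `⋀_{i ≤ h} (□*(□* φ → B_i) → B_i)`. -/
noncomputable def translation (L : Set (Formula n)) (h : ℕ) (B : ℕ → Formula n)
    (φ : Formula n) : Formula n :=
  .bigAnd ((List.range (h + 1)).map fun i =>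
    .imp (boxStar L (.imp (boxStar L φ) (B i))) (B i))

end ModalLogic

/-!
In the `k`-canonical frame of the pretransitive logic `L` the operator `◇*` defines the relation
`R*`. Consequently the substitution instances of `B_i` by `k`-formulas all belong to a point and its
successors exactly when its depth is at most `i`, and the points containing the `k`-formulas of
`L[i]` are those of depth at most `i`. As `L[h]` is `k`-tabular, finitely many `k`-formulas
axiomatize its `k`-formulas over `L`, and there are only finitely many points of depth at most `h`;
hence every set of such points is defined by a `k`-formula.

By the same token `φ ∈ L[h + 1]` means that `φ` holds at all points of depth at most `h + 1`. By
compactness each point of depth greater than `i` sees a maximal such point, and the depth of the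
latter is `i + 1`. Hence `φ` holds at all points of depth at most `h + 1` iff, for each `i ≤ h`, no
point of depth greater than `i` sees only points of depth at most `i` among those where `□* φ`
holds; this is what the translation says.
-/

section Order

theorem chainHeight_univ_le_iff_krullDim_lt {α : Type*} [PartialOrder α] (n : ℕ) :
    (Set.univ : Set α).chainHeight (· ≤ ·) ≤ n ↔ Order.krullDim α < n := by
  classical
  rw [Order.krullDim_lt_coe_iff]
  constructor
  · intro h p
    have hcard : (Set.range p.toFun).encard = (p.length + 1 : ℕ) := by
      rw [← Set.image_univ, p.strictMono.injective.encard_image, Set.encard_univ]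
      simp
    have hle := (Set.encard_le_chainHeight_of_isChain (Set.univ : Set α) _ (Set.subset_univ _)
      p.strictMono.monotone.isChain_range).trans h
    rw [hcard, Nat.cast_le] at hle
    exact hle
  · intro h
    by_contra! hlt
    obtain ⟨t, -, hcard, hchain⟩ :=
      Set.exists_isChain_of_le_chainHeight (n + 1) (by simpa using Order.add_one_le_of_lt hlt)
    let _ : LinearOrder t := hchain.linearOrder
    let _ : Fintype t := (Set.finite_of_encard_eq_coe hcard).fintype
    have hcard' : Fintype.card t = n + 1 := by
      rw [← ENat.natCast_inj, Set.coe_fintypeCard, hcard]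
    let e : Fin (n + 1) ≃o t := Fintype.orderIsoFinOfCardEq t hcard'
    let p : LTSeries α := ⟨n, fun i => e i, fun i => e.strictMono i.castSucc_lt_succ⟩
    exact lt_irrefl n (h p)

variable {α : Type*} [Preorder α]

theorem krullDim_antisymmetrization :
    Order.krullDim (Antisymmetrization α (· ≤ ·)) = Order.krullDim α :=
  le_antisymm
    (Order.krullDim_le_of_strictMono _ fun _ _ =>
      ofAntisymmetrization_lt_ofAntisymmetrization_iff.2)
    (Order.krullDim_le_of_strictMono _ fun _ _ =>
      toAntisymmetrization_lt_toAntisymmetrization_iff.2)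

theorem coheight_lt_succ_iff (i : ℕ) (x : α) :
    Order.coheight x < (i + 1 : ℕ) ↔ ∀ y > x, Order.coheight y < i := by
  rw [← Order.coheight_le_coe_iff, Nat.cast_add_one, ENat.lt_add_one_iff (ENat.natCast_ne_top i)]

/-- If `y` is maximal among the points of coheight at least `i`, then its coheight is exactly `i`:
this is what makes the validity of `V` on the points of coheight at most `h` expressible by
Löb-style conditions, one for each `i ≤ h`. -/
theorem forall_coheight_lt_succ_iff {V : Set α} {h : ℕ}
    (hmax : ∀ i ≤ h, ∀ x : α, ¬ Order.coheight x < i →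
      ∃ y ≥ x, Maximal (fun z => ¬ Order.coheight z < i) y) :
    (∀ x : α, Order.coheight x < (h + 1 : ℕ) → x ∈ V) ↔
      ∀ i ≤ h, ∀ x : α,
        (∀ y ≥ x, Set.Ici y ⊆ V → Order.coheight y < i) → Order.coheight x < i := by
  constructor
  · intro hV i hi x hx
    by_contra hxi
    obtain ⟨y, hxy, hy⟩ := hmax i hi x hxi
    have hyi : Order.coheight y < (i + 1 : ℕ) :=
      (coheight_lt_succ_iff i y).2 fun z hz => not_not.1 (hy.not_prop_of_gt hz)
    refine hy.prop (hx y hxy fun z hz => hV z ?_)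
    exact (Order.coheight_anti hz).trans_lt (hyi.trans_le (by exact_mod_cast Nat.succ_le_succ hi))
  · intro H
    have hV : ∀ i ≤ h + 1, ∀ x : α, Order.coheight x < i → x ∈ V := by
      intro i
      induction i with
      | zero => simp
      | succ i ih =>
        intro hi x hx
        by_contra hxV
        refine hxV (ih (by omega) x (H i (by omega) x fun y hxy hyV => ?_))
        exact (coheight_lt_succ_iff i x).1 hx y (lt_of_le_not_ge hxy fun hyx => hxV (hyV hyx))
    exact hV (h + 1) le_rfl

end Order

namespace KripkeFrame

variable {n : ℕ} (F : KripkeFrame n)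

theorem relStar_cone_iff (x : F.W) (y z : (F.cone x).W) :
    (F.cone x).relStar y z ↔ F.relStar y.1 z.1 := by
  constructor
  · exact fun h => Relation.ReflTransGen.lift (p := F.rel) Subtype.val (fun _ _ h => h) _ _ h
  · obtain ⟨z, hz⟩ := z
    intro (h : F.relStar y.1 z)
    induction h with
    | refl => exact Relation.ReflTransGen.refl
    | tail hyb hbc ih => exact (ih (y.2.trans hyb)).tail hbc

attribute [local instance] toPreorder

theorem depth_le_iff_coheight_lt (x : F.W) (i : ℕ) :
    F.depth x ≤ (i : ℕ∞) ↔ Order.coheight x < (i : ℕ∞) := by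
  have cone_toPreorder : (F.cone x).toPreorder = (inferInstance : Preorder (Set.Ici x)) :=
    Preorder.ext fun y z => F.relStar_cone_iff x y z
  have krullDim_cone : @Order.krullDim (Set.Ici x) (F.cone x).toPreorder = Order.coheight x := by
    rw [cone_toPreorder, Order.coheight_eq_krullDim_Ici]
  rw [depth, height, chainHeight_univ_le_iff_krullDim_lt, krullDim_antisymmetrization,
    ← WithBot.coe_lt_coe (a := Order.coheight x), ← krullDim_cone]
  rfl

end KripkeFrame
namespace Formula

variable {n : ℕ}

section Eval

variable (v : Formula n → Prop) (φ ψ : Formula n) (l : List (Formula n))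

@[simp] theorem eval_bot : eval v bot ↔ False := Iff.rfl

@[simp] theorem eval_imp : eval v (imp φ ψ) ↔ (eval v φ → eval v ψ) := Iff.rfl

@[simp] theorem eval_neg : eval v (neg φ) ↔ ¬ eval v φ := Iff.rfl

@[simp] theorem eval_or : eval v (or φ ψ) ↔ eval v φ ∨ eval v ψ := by
  simp only [or, eval_imp, eval_neg]; tauto

@[simp] theorem eval_and : eval v (and φ ψ) ↔ eval v φ ∧ eval v ψ := by
  simp only [and, eval_imp, eval_neg]; tauto

@[simp] theorem eval_iff : eval v (iff φ ψ) ↔ (eval v φ ↔ eval v ψ) := by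
  simp only [iff, eval_imp, eval_and]; tauto

@[simp] theorem eval_bigAnd : eval v (bigAnd l) ↔ ∀ χ ∈ l, eval v χ := by
  induction l with
  | nil => simp [bigAnd]
  | cons χ l ih =>
    change eval v (and χ (bigAnd l)) ↔ _
    simp [ih]

end Eval

section KFormula

variable {k : ℕ} {φ ψ : Formula n} {l : List (Formula n)}

@[simp] theorem isKFormula_bot : (bot : Formula n).IsKFormula k := trivial

@[simp] theorem isKFormula_imp : (imp φ ψ).IsKFormula k ↔ φ.IsKFormula k ∧ ψ.IsKFormula k :=
  Iff.rfl

@[simp] theorem isKFormula_neg : (neg φ).IsKFormula k ↔ φ.IsKFormula k := by simp [neg]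

@[simp] theorem isKFormula_or : (or φ ψ).IsKFormula k ↔ φ.IsKFormula k ∧ ψ.IsKFormula k := by
  simp [or]

@[simp] theorem isKFormula_and : (and φ ψ).IsKFormula k ↔ φ.IsKFormula k ∧ ψ.IsKFormula k := by
  simp [and]

@[simp] theorem isKFormula_iff : (iff φ ψ).IsKFormula k ↔ φ.IsKFormula k ∧ ψ.IsKFormula k := by
  simp [iff]; tauto

@[simp] theorem isKFormula_bigOr : (bigOr l).IsKFormula k ↔ ∀ χ ∈ l, χ.IsKFormula k := by
  induction l with
  | nil => simp [bigOr]
  | cons χ l ih =>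
    change (or χ (bigOr l)).IsKFormula k ↔ _
    simp [ih]

@[simp] theorem isKFormula_bigAnd : (bigAnd l).IsKFormula k ↔ ∀ χ ∈ l, χ.IsKFormula k := by
  induction l with
  | nil => simp [bigAnd]
  | cons χ l ih =>
    change (and χ (bigAnd l)).IsKFormula k ↔ _
    simp [ih]

theorem IsKFormula.mono {k' : ℕ} (hk : k ≤ k') (h : φ.IsKFormula k) : φ.IsKFormula k' := by
  induction φ with
  | var p => exact lt_of_lt_of_le (show p < k from h) hk
  | bot => trivial
  | imp φ ψ ih₁ ih₂ => exact ⟨ih₁ h.1, ih₂ h.2⟩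
  | dia i φ ih => exact ih h

theorem IsKFormula.subst (s : ℕ → Formula n) (hs : ∀ p, (s p).IsKFormula k) (φ : Formula n) :
    (φ.subst s).IsKFormula k := by
  induction φ with
  | var p => exact hs p
  | bot => trivial
  | imp φ ψ ih₁ ih₂ => exact ⟨ih₁, ih₂⟩
  | dia _ _ ih => exact ih

theorem IsKFormula.subst_congr {s t : ℕ → Formula n} (hst : ∀ p < k, s p = t p)
    (h : φ.IsKFormula k) : φ.subst s = φ.subst t := by
  induction φ with
  | var p => exact hst p h
  | bot => rfl
  | imp φ ψ ih₁ ih₂ => simp only [Formula.subst, ih₁ h.1, ih₂ h.2]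
  | dia i φ ih => simp only [Formula.subst, ih h]

end KFormula

section Subst

variable (s : ℕ → Formula n) (φ ψ : Formula n)

@[simp] theorem subst_imp : (imp φ ψ).subst s = imp (φ.subst s) (ψ.subst s) := rfl

@[simp] theorem subst_dia (i : Fin n) : (dia i φ).subst s = dia i (φ.subst s) := rfl

@[simp] theorem subst_neg : (neg φ).subst s = neg (φ.subst s) := rfl

@[simp] theorem subst_or : (or φ ψ).subst s = or (φ.subst s) (ψ.subst s) := rfl

theorem subst_bigOr (l : List (Formula n)) :
    (bigOr l).subst s = bigOr (l.map fun χ => χ.subst s) := by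
  induction l with
  | nil => rfl
  | cons χ l ih =>
    change (or χ (bigOr l)).subst s = or (χ.subst s) (bigOr _)
    rw [subst_or, ih]

@[simp] theorem subst_diaAny : (diaAny φ).subst s = diaAny (φ.subst s) := by
  simp [diaAny, subst_bigOr, Function.comp_def]

@[simp] theorem subst_diaPow (m : ℕ) : (diaPow m φ).subst s = diaPow m (φ.subst s) := by
  induction m generalizing φ with
  | zero => rfl
  | succ m ih => simp [diaPow, ih]

@[simp] theorem subst_diaLe (m : ℕ) : (diaLe m φ).subst s = diaLe m (φ.subst s) := by
  simp [diaLe, subst_bigOr, Function.comp_def]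

@[simp] theorem subst_boxLe (m : ℕ) : (boxLe m φ).subst s = boxLe m (φ.subst s) := by
  simp [boxLe]

theorem subst_subst (t : ℕ → Formula n) :
    (φ.subst s).subst t = φ.subst fun p => (s p).subst t := by
  induction φ with
  | var p => rfl
  | bot => rfl
  | imp φ ψ ih₁ ih₂ => simp [ih₁, ih₂]
  | dia i φ ih => simp [ih]

theorem subst_eq_self {k : ℕ} {φ : Formula n} (hφ : φ.IsKFormula k)
    (hs : ∀ p < k, s p = var p) : φ.subst s = φ := by
  induction φ with
  | var p => exact hs p hφ
  | bot => rfl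
  | imp φ ψ ih₁ ih₂ => simp [ih₁ hφ.1, ih₂ hφ.2]
  | dia i φ ih => simp [ih hφ]

end Subst

end Formula

namespace IsLogic

variable {n : ℕ} {L : Set (Formula n)} {φ ψ χ : Formula n}

theorem mem_of_eval (hL : IsLogic L) (hφ : φ ∈ L) (h : ∀ v, φ.eval v → ψ.eval v) : ψ ∈ L :=
  hL.mp φ ψ (hL.taut _ h) hφ

theorem mem_of_eval₂ (hL : IsLogic L) (hφ : φ ∈ L) (hψ : ψ ∈ L)
    (h : ∀ v, φ.eval v → ψ.eval v → χ.eval v) : χ ∈ L :=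
  hL.mp ψ χ (hL.mp φ _ (hL.taut _ h) hφ) hψ

end IsLogic

namespace ModalLogic

variable {n : ℕ} {L : Set (Formula n)} {k : ℕ}

/-- `d` behaves in `L` like a normal diamond. The compound modalities `◇`, `◇^m`, `◇^{≤m}` and
`◇*` are treated on a par with the `◇_i` through this notion. -/
structure IsDiamond (L : Set (Formula n)) (d : Formula n → Formula n) : Prop where
  isKFormula {k : ℕ} {φ : Formula n} : φ.IsKFormula k → (d φ).IsKFormula k
  mono {φ ψ : Formula n} : .imp φ ψ ∈ L → .imp (d φ) (d ψ) ∈ L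
  or (φ ψ : Formula n) : .imp (d (.or φ ψ)) (.or (d φ) (d ψ)) ∈ L
  bot : .neg (d .bot) ∈ L

section Diamond

variable {d e : Formula n → Formula n}

theorem IsDiamond.box_mem (hL : IsLogic L) (hd : IsDiamond L d) {φ : Formula n} (hφ : φ ∈ L) :
    .neg (d (.neg φ)) ∈ L := by
  have h : .imp (d (.neg φ)) (d .bot) ∈ L := hd.mono (hL.mem_of_eval hφ fun v => by simp)
  exact hL.mem_of_eval₂ h hd.bot fun v => by simp; tauto

theorem IsDiamond.iff_mem (hL : IsLogic L) (hd : IsDiamond L d) {φ ψ : Formula n}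
    (h : .iff φ ψ ∈ L) : .iff (d φ) (d ψ) ∈ L := by
  have hφψ : .imp φ ψ ∈ L := hL.mem_of_eval h fun v => by simp; tauto
  have hψφ : .imp ψ φ ∈ L := hL.mem_of_eval h fun v => by simp; tauto
  exact hL.mem_of_eval₂ (hd.mono hφψ) (hd.mono hψφ) fun v => by simp; tauto

theorem isDiamond_id (hL : IsLogic L) : IsDiamond L id where
  isKFormula := id
  mono := id
  or _ _ := hL.taut _ fun v => by simp
  bot := hL.taut _ fun v => by simp

theorem isDiamond_dia (hL : IsLogic L) (i : Fin n) : IsDiamond L (.dia i) where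
  isKFormula := id
  mono := hL.mono i _ _
  or φ ψ := hL.subst (fun p => if p = 0 then φ else ψ) _ (hL.dia_or i)
  bot := hL.dia_bot i

theorem IsDiamond.comp (hL : IsLogic L) (hd : IsDiamond L d) (he : IsDiamond L e) :
    IsDiamond L (d ∘ e) where
  isKFormula hφ := hd.isKFormula (he.isKFormula hφ)
  mono h := hd.mono (he.mono h)
  or φ ψ := hL.mem_of_eval₂ (hd.mono (he.or φ ψ)) (hd.or (e φ) (e ψ)) fun v => by simp; tauto
  bot := hL.mem_of_eval₂ (hd.mono he.bot) hd.bot fun v => by simp; tauto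

theorem isDiamond_const_bot (hL : IsLogic L) : IsDiamond L fun _ => .bot where
  isKFormula _ := trivial
  mono _ := hL.taut _ fun v => by simp
  or _ _ := hL.taut _ fun v => by simp
  bot := hL.taut _ fun v => by simp

theorem IsDiamond.sup (hL : IsLogic L) (hd : IsDiamond L d) (he : IsDiamond L e) :
    IsDiamond L fun φ => .or (d φ) (e φ) where
  isKFormula hφ := Formula.isKFormula_or.2 ⟨hd.isKFormula hφ, he.isKFormula hφ⟩
  mono h := hL.mem_of_eval₂ (hd.mono h) (he.mono h) fun v => by simp; tauto
  or φ ψ := hL.mem_of_eval₂ (hd.or φ ψ) (he.or φ ψ) fun v => by simp; tauto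
  bot := hL.mem_of_eval₂ hd.bot he.bot fun v => by simp; tauto

theorem isDiamond_bigOr (hL : IsLogic L) {ι : Type*} {f : ι → Formula n → Formula n}
    (hf : ∀ i, IsDiamond L (f i)) (l : List ι) :
    IsDiamond L fun φ => .bigOr (l.map fun i => f i φ) := by
  induction l with
  | nil => exact isDiamond_const_bot hL
  | cons i l ih => exact (hf i).sup hL ih

theorem isDiamond_diaAny (hL : IsLogic L) : IsDiamond L .diaAny :=
  isDiamond_bigOr hL (isDiamond_dia hL) _

theorem isDiamond_diaPow (hL : IsLogic L) : ∀ m, IsDiamond L (.diaPow m)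
  | 0 => isDiamond_id hL
  | m + 1 => (isDiamond_diaPow hL m).comp hL (isDiamond_diaAny hL)

theorem isDiamond_diaLe (hL : IsLogic L) (m : ℕ) : IsDiamond L (.diaLe m) :=
  isDiamond_bigOr hL (isDiamond_diaPow hL) _

theorem isDiamond_diaStar {L' : Set (Formula n)} (hL' : IsLogic L') : IsDiamond L' (diaStar L) :=
  isDiamond_diaLe hL' _

end Diamond

theorem isMTransitive_transIndex (hpre : IsPretransitive L) : IsMTransitive L (transIndex L) :=
  Nat.sInf_mem (s := {m | IsMTransitive L m}) hpre

section MaxConsistent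

theorem exists_isMaxConsistent {Γ : Set (Formula n)} (hΓ : ∀ ψ ∈ Γ, ψ.IsKFormula k)
    (hcons : IsConsistentSet L Γ) : ∃ x, IsMaxConsistent L k x ∧ Γ ⊆ x := by
  obtain ⟨x, hx, hmax⟩ := zorn_subset_nonempty
    {Γ : Set (Formula n) | (∀ ψ ∈ Γ, ψ.IsKFormula k) ∧ IsConsistentSet L Γ}
    (fun c hc hchain hne => by
      refine ⟨⋃₀ c, ⟨?_, ?_⟩, fun s hs => Set.subset_sUnion_of_mem hs⟩
      · rintro ψ ⟨s, hs, hψ⟩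
        exact (hc hs).1 ψ hψ
      · intro l hl
        obtain ⟨s, hs, hsub⟩ := hchain.directedOn.exists_mem_subset_of_finite_of_subset_sUnion
          hne l.finite_toSet hl
        exact (hc hs).2 l hsub)
    Γ ⟨hΓ, hcons⟩
  exact ⟨x, hmax, hx⟩

namespace IsMaxConsistent

variable {x y : Set (Formula n)} {φ ψ : Formula n}

theorem isKFormula (hx : IsMaxConsistent L k x) (h : φ ∈ x) : φ.IsKFormula k := hx.1.1 φ h

theorem exists_imp_neg_mem_of_notMem (hL : IsLogic L) (hx : IsMaxConsistent L k x)
    (hφ : φ.IsKFormula k) (hφx : φ ∉ x) :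
    ∃ l : List (Formula n), (∀ ψ ∈ l, ψ ∈ x) ∧ .imp (.bigAnd l) (.neg φ) ∈ L := by
  classical
  by_contra! h
  refine hφx (hx.2 (y := insert φ x) ⟨?_, fun l hl hbad => ?_⟩ (Set.subset_insert _ _)
    (Set.mem_insert _ _))
  · rintro ψ (rfl | hψ)
    exacts [hφ, hx.isKFormula hψ]
  · refine h (l.filter (· ≠ φ)) ?_ (hL.mem_of_eval hbad fun v => ?_)
    · simp only [List.mem_filter, decide_eq_true_eq]
      exact fun ψ hψ => (hl ψ hψ.1).resolve_left hψ.2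
    · simp only [Formula.eval_imp, Formula.eval_neg, Formula.eval_bigAnd, List.mem_filter,
        decide_eq_true_eq]
      intro hl hfilter hφ
      exact hl fun χ hχ => by_cases (fun h : χ = φ => h ▸ hφ) fun h => hfilter χ ⟨hχ, h⟩

theorem mem_of_imp_bigAnd_mem (hL : IsLogic L) (hx : IsMaxConsistent L k x)
    {l : List (Formula n)} (hl : ∀ ψ ∈ l, ψ ∈ x) (hφ : φ.IsKFormula k)
    (h : .imp (.bigAnd l) φ ∈ L) : φ ∈ x := by
  by_contra hφx
  obtain ⟨l', hl', h'⟩ := hx.exists_imp_neg_mem_of_notMem hL hφ hφx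
  refine hx.1.2 (l ++ l') (fun ψ hψ => (List.mem_append.1 hψ).elim (hl ψ) (hl' ψ)) ?_
  refine hL.mem_of_eval₂ h h' fun v => ?_
  simp only [Formula.eval_imp, Formula.eval_neg, Formula.eval_bigAnd, List.mem_append]
  exact fun hφ hnφ hv => hnφ (fun χ hχ => hv χ (.inr hχ)) (hφ fun χ hχ => hv χ (.inl hχ))

theorem mem_of_mem (hL : IsLogic L) (hx : IsMaxConsistent L k x) (hφ : φ.IsKFormula k)
    (h : φ ∈ L) : φ ∈ x :=
  hx.mem_of_imp_bigAnd_mem hL (l := []) (by simp) hφ (hL.mem_of_eval h fun v => by simp)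

theorem mem_of_imp_mem (hL : IsLogic L) (hx : IsMaxConsistent L k x) (hψ : ψ.IsKFormula k)
    (h : .imp φ ψ ∈ L) (hφ : φ ∈ x) : ψ ∈ x :=
  hx.mem_of_imp_bigAnd_mem hL (l := [φ]) (by simpa) hψ (hL.mem_of_eval h fun v => by simp)

theorem bot_notMem (hL : IsLogic L) (hx : IsMaxConsistent L k x) : .bot ∉ x := fun h =>
  hx.1.2 [.bot] (by simpa) (hL.taut _ fun v => by simp)

theorem neg_mem_iff (hL : IsLogic L) (hx : IsMaxConsistent L k x) (hφ : φ.IsKFormula k) :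
    .neg φ ∈ x ↔ φ ∉ x := by
  constructor
  · intro h h'
    exact hx.1.2 [φ, .neg φ] (by simp [h, h']) (hL.taut _ fun v => by simp)
  · intro h
    obtain ⟨l, hl, hlφ⟩ := hx.exists_imp_neg_mem_of_notMem hL hφ h
    exact hx.mem_of_imp_bigAnd_mem hL hl (by simpa) hlφ

theorem imp_mem_iff (hL : IsLogic L) (hx : IsMaxConsistent L k x) (hφ : φ.IsKFormula k)
    (hψ : ψ.IsKFormula k) : .imp φ ψ ∈ x ↔ (φ ∈ x → ψ ∈ x) := by
  constructor
  · intro h h'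
    exact hx.mem_of_imp_bigAnd_mem hL (l := [φ, .imp φ ψ]) (by simp [h, h']) hψ
      (hL.taut _ fun v => by simp; tauto)
  · intro h
    by_cases h' : φ ∈ x
    · exact hx.mem_of_imp_mem hL ⟨hφ, hψ⟩ (hL.taut _ fun v => by simp; tauto) (h h')
    · exact hx.mem_of_imp_mem hL (φ := .neg φ) ⟨hφ, hψ⟩ (hL.taut _ fun v => by simp; tauto)
        ((hx.neg_mem_iff hL hφ).2 h')

theorem or_mem_iff (hL : IsLogic L) (hx : IsMaxConsistent L k x) (hφ : φ.IsKFormula k)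
    (hψ : ψ.IsKFormula k) : .or φ ψ ∈ x ↔ φ ∈ x ∨ ψ ∈ x := by
  rw [Formula.or, hx.imp_mem_iff hL (by simpa) hψ, hx.neg_mem_iff hL hφ]
  tauto

theorem and_mem_iff (hL : IsLogic L) (hx : IsMaxConsistent L k x) (hφ : φ.IsKFormula k)
    (hψ : ψ.IsKFormula k) : .and φ ψ ∈ x ↔ φ ∈ x ∧ ψ ∈ x := by
  rw [Formula.and, hx.neg_mem_iff hL (by simp [hφ, hψ]), hx.imp_mem_iff hL hφ (by simpa),
    hx.neg_mem_iff hL hψ]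
  tauto

theorem iff_mem_iff (hL : IsLogic L) (hx : IsMaxConsistent L k x) (hφ : φ.IsKFormula k)
    (hψ : ψ.IsKFormula k) : .iff φ ψ ∈ x ↔ (φ ∈ x ↔ ψ ∈ x) := by
  rw [Formula.iff, hx.and_mem_iff hL (by simp [hφ, hψ]) (by simp [hφ, hψ]),
    hx.imp_mem_iff hL hφ hψ, hx.imp_mem_iff hL hψ hφ]
  tauto

theorem bigOr_mem_iff (hL : IsLogic L) (hx : IsMaxConsistent L k x) {l : List (Formula n)}
    (hl : ∀ χ ∈ l, χ.IsKFormula k) : .bigOr l ∈ x ↔ ∃ χ ∈ l, χ ∈ x := by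
  induction l with
  | nil => simpa [Formula.bigOr] using hx.bot_notMem hL
  | cons χ l ih =>
    simp only [List.mem_cons, forall_eq_or_imp] at hl
    change Formula.or χ (.bigOr l) ∈ x ↔ _
    rw [hx.or_mem_iff hL hl.1 (by simpa using hl.2), ih hl.2]
    simp

theorem bigAnd_mem_iff (hL : IsLogic L) (hx : IsMaxConsistent L k x) {l : List (Formula n)}
    (hl : ∀ χ ∈ l, χ.IsKFormula k) : .bigAnd l ∈ x ↔ ∀ χ ∈ l, χ ∈ x := by
  induction l with
  | nil => simpa [Formula.bigAnd] using (hx.neg_mem_iff hL (by simp)).2 (hx.bot_notMem hL)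
  | cons χ l ih =>
    simp only [List.mem_cons, forall_eq_or_imp] at hl
    change Formula.and χ (.bigAnd l) ∈ x ↔ _
    rw [hx.and_mem_iff hL hl.1 (by simpa using hl.2), ih hl.2]
    simp

end IsMaxConsistent

/-- Prime filter theorem for the Lindenbaum algebra of `L`: a filter base `Δ` and an ideal base
`I`, no member of `Δ` being below a member of `I`, are separated by a prime filter. -/
theorem exists_canonical_separating (hL : IsLogic L) {Δ I : Set (Formula n)}
    (hΔk : ∀ δ ∈ Δ, δ.IsKFormula k) (hIk : ∀ ι ∈ I, ι.IsKFormula k) (hΔ : Δ.Nonempty)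
    (hdir : ∀ φ ∈ Δ, ∀ ψ ∈ Δ, ∃ χ ∈ Δ, .imp χ φ ∈ L ∧ .imp χ ψ ∈ L)
    (hbot : .bot ∈ I) (hor : ∀ φ ∈ I, ∀ ψ ∈ I, .or φ ψ ∈ I)
    (hsep : ∀ δ ∈ Δ, ∀ ι ∈ I, .imp δ ι ∉ L) :
    ∃ x : (canonicalFrame L k).W, Δ ⊆ x.1 ∧ ∀ ι ∈ I, ι ∉ x.1 := by
  have exists_imp_or_mem : ∀ l : List (Formula n), (∀ χ ∈ l, χ ∈ Δ ∪ Formula.neg '' I) →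
      ∃ δ ∈ Δ, ∃ ι ∈ I, .imp δ (.or (.bigAnd l) ι) ∈ L := by
    intro l
    induction l with
    | nil =>
      obtain ⟨δ, hδ⟩ := hΔ
      exact fun _ => ⟨δ, hδ, .bot, hbot, hL.taut _ fun v => by simp⟩
    | cons χ l ih =>
      simp only [List.mem_cons, forall_eq_or_imp]
      rintro ⟨hχ, hl⟩
      obtain ⟨δ, hδ, ι, hι, hlι⟩ := ih hl
      rcases hχ with hχ | ⟨ι', hι', rfl⟩
      · obtain ⟨δ', hδ', hδ'δ, hδ'χ⟩ := hdir δ hδ χ hχ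
        have h : .imp δ' (.or (.bigAnd l) ι) ∈ L :=
          hL.mem_of_eval₂ hδ'δ hlι fun v => by simp; tauto
        exact ⟨δ', hδ', ι, hι, hL.mem_of_eval₂ h hδ'χ fun v => by simp; tauto⟩
      · exact ⟨δ, hδ, _, hor ι' hι' ι hι, hL.mem_of_eval hlι fun v => by simp; tauto⟩
  obtain ⟨x, hx, hsub⟩ := exists_isMaxConsistent (L := L) (k := k) (Γ := Δ ∪ Formula.neg '' I)
    (by
      rintro _ (hδ | ⟨ι, hι, rfl⟩)
      exacts [hΔk _ hδ, Formula.isKFormula_neg.2 (hIk ι hι)])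
    (fun l hl hbad => by
      obtain ⟨δ, hδ, ι, hι, h⟩ := exists_imp_or_mem l hl
      exact hsep δ hδ ι hι (hL.mem_of_eval₂ hbad h fun v => by simp; tauto))
  exact ⟨⟨x, hx⟩, fun δ hδ => hsub (.inl hδ), fun ι hι =>
    (hx.neg_mem_iff hL (hIk ι hι)).1 (hsub (.inr ⟨ι, hι, rfl⟩))⟩

end MaxConsistent

section CanonicalRel

/-- The accessibility relation of the diamond-like operator `d` on the `k`-canonical frame;
for `d = ◇_i` it is `R_i`. -/
def canonicalRel (d : Formula n → Formula n) (x y : (canonicalFrame L k).W) : Prop :=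
  ∀ φ ∈ y.1, d φ ∈ x.1

variable {d e : Formula n → Formula n} {x y : (canonicalFrame L k).W}

theorem IsDiamond.exists_canonicalRel (hL : IsLogic L) (hd : IsDiamond L d) {Δ : Set (Formula n)}
    (hΔk : ∀ δ ∈ Δ, δ.IsKFormula k) (hΔ : Δ.Nonempty)
    (hdir : ∀ φ ∈ Δ, ∀ ψ ∈ Δ, ∃ χ ∈ Δ, .imp χ φ ∈ L ∧ .imp χ ψ ∈ L)
    (hΔx : ∀ δ ∈ Δ, d δ ∈ x.1) : ∃ y, canonicalRel d x y ∧ Δ ⊆ y.1 := by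
  have bot_notMem : d .bot ∉ x.1 :=
    (x.2.neg_mem_iff hL (hd.isKFormula Formula.isKFormula_bot)).1
      (x.2.mem_of_mem hL (by simpa using hd.isKFormula Formula.isKFormula_bot) hd.bot)
  have or_notMem {φ ψ : Formula n} (hφ : φ.IsKFormula k ∧ d φ ∉ x.1)
      (hψ : ψ.IsKFormula k ∧ d ψ ∉ x.1) : d (.or φ ψ) ∉ x.1 := fun h => by
    have hk := And.intro (hd.isKFormula hφ.1) (hd.isKFormula hψ.1)
    rcases (x.2.or_mem_iff hL hk.1 hk.2).1
      (x.2.mem_of_imp_mem hL (Formula.isKFormula_or.2 hk) (hd.or φ ψ) h) with h | h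
    exacts [hφ.2 h, hψ.2 h]
  obtain ⟨y, hΔy, hy⟩ := exists_canonical_separating hL
    (I := {ι | ι.IsKFormula k ∧ d ι ∉ x.1}) hΔk (fun _ hι => hι.1) hΔ hdir
    ⟨Formula.isKFormula_bot, bot_notMem⟩
    (fun φ hφ ψ hψ => ⟨Formula.isKFormula_or.2 ⟨hφ.1, hψ.1⟩, or_notMem hφ hψ⟩)
    fun δ hδ ι hι h => hι.2 (x.2.mem_of_imp_mem hL (hd.isKFormula hι.1) (hd.mono h) (hΔx δ hδ))
  exact ⟨y, fun φ hφ => not_not.1 fun h => hy φ ⟨y.2.isKFormula hφ, h⟩ hφ, hΔy⟩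

theorem IsDiamond.mem_iff (hL : IsLogic L) (hd : IsDiamond L d) {φ : Formula n}
    (hφ : φ.IsKFormula k) : d φ ∈ x.1 ↔ ∃ y, canonicalRel d x y ∧ φ ∈ y.1 := by
  have imp_self_mem : .imp φ φ ∈ L := hL.taut _ fun v => by simp
  constructor
  · intro h
    simpa using hd.exists_canonicalRel hL (Δ := {φ}) (by simpa) (Set.singleton_nonempty φ)
      (by simpa using imp_self_mem) (by simpa)
  · rintro ⟨y, hxy, hy⟩
    exact hxy φ hy

theorem canonicalRel_id_iff : canonicalRel id x y ↔ x = y :=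
  ⟨fun h => Subtype.ext (Set.Subset.antisymm (y.2.2 x.2.1 h) h), fun h _ hφ => h ▸ hφ⟩

theorem canonicalRel_comp_iff (hL : IsLogic L) (hd : IsDiamond L d) (he : IsDiamond L e) :
    canonicalRel (d ∘ e) x y ↔ ∃ z, canonicalRel d x z ∧ canonicalRel e z y := by
  constructor
  · intro h
    have top_mem : .neg .bot ∈ y.1 := y.2.mem_of_mem hL (by simp) (hL.taut _ fun v => by simp)
    obtain ⟨z, hxz, hz⟩ := hd.exists_canonicalRel hL (Δ := e '' y.1)
      (Set.forall_mem_image.2 fun φ hφ => he.isKFormula (y.2.isKFormula hφ))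
      ⟨_, Set.mem_image_of_mem e top_mem⟩
      (by
        rintro _ ⟨φ, hφ, rfl⟩ _ ⟨ψ, hψ, rfl⟩
        have and_mem : .and φ ψ ∈ y.1 :=
          (y.2.and_mem_iff hL (y.2.isKFormula hφ) (y.2.isKFormula hψ)).2 ⟨hφ, hψ⟩
        exact ⟨_, Set.mem_image_of_mem e and_mem, he.mono (hL.taut _ fun v => by simp; tauto),
          he.mono (hL.taut _ fun v => by simp)⟩)
      (Set.forall_mem_image.2 h)
    exact ⟨z, hxz, Set.image_subset_iff.1 hz⟩
  · rintro ⟨z, hxz, hzy⟩ φ hφ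
    exact hxz _ (hzy φ hφ)

theorem canonicalRel_bigOr_iff (hL : IsLogic L) {ι : Type*} {f : ι → Formula n → Formula n}
    (hf : ∀ i, IsDiamond L (f i)) (l : List ι) :
    canonicalRel (fun φ => .bigOr (l.map fun i => f i φ)) x y ↔
      ∃ i ∈ l, canonicalRel (f i) x y := by
  have bigOr_mem_iff {φ : Formula n} (hφ : φ.IsKFormula k) :
      .bigOr (l.map fun i => f i φ) ∈ x.1 ↔ ∃ i ∈ l, f i φ ∈ x.1 := by
    rw [x.2.bigOr_mem_iff hL (by simpa using fun i _ => (hf i).isKFormula hφ)]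
    simp
  constructor
  · intro h
    by_contra! hl
    have hl' : ∀ i ∈ l, ∃ φ ∈ y.1, f i φ ∉ x.1 := fun i hi => by
      simpa [canonicalRel] using hl i hi
    have : Nonempty (Formula n) := ⟨.bot⟩
    choose! φ hφ hφx using hl'
    have hφk : ∀ χ ∈ l.map φ, χ.IsKFormula k := by
      simpa using fun i hi => y.2.isKFormula (hφ i hi)
    have bigAnd_mem : .bigAnd (l.map φ) ∈ y.1 := (y.2.bigAnd_mem_iff hL hφk).2 (by simpa)
    obtain ⟨i, hi, hix⟩ := (bigOr_mem_iff (y.2.isKFormula bigAnd_mem)).1 (h _ bigAnd_mem)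
    have imp_mem : .imp (.bigAnd (l.map φ)) (φ i) ∈ L :=
      hL.taut _ fun v => by simpa using fun hv => hv i hi
    exact hφx i hi (x.2.mem_of_imp_mem hL
      ((hf i).isKFormula (y.2.isKFormula (hφ i hi))) ((hf i).mono imp_mem) hix)
  · rintro ⟨i, hi, hxy⟩ φ hφ
    exact (bigOr_mem_iff (y.2.isKFormula hφ)).2 ⟨i, hi, hxy φ hφ⟩

theorem canonicalRel_diaAny_iff (hL : IsLogic L) :
    canonicalRel .diaAny x y ↔ (canonicalFrame L k).rel x y :=
  (canonicalRel_bigOr_iff hL (isDiamond_dia hL) _).trans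
    (exists_congr fun i => and_iff_right (List.mem_finRange i))

theorem canonicalRel_diaPow_succ_iff (hL : IsLogic L) (m : ℕ) :
    canonicalRel (.diaPow (m + 1)) x y ↔
      ∃ z, canonicalRel (.diaPow m) x z ∧ (canonicalFrame L k).rel z y := by
  simp only [← canonicalRel_diaAny_iff hL]
  exact canonicalRel_comp_iff hL (isDiamond_diaPow hL m) (isDiamond_diaAny hL)

theorem canonicalRel_diaLe_iff (hL : IsLogic L) (m : ℕ) :
    canonicalRel (.diaLe m) x y ↔ ∃ l ≤ m, canonicalRel (.diaPow l) x y :=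
  (canonicalRel_bigOr_iff hL (isDiamond_diaPow hL) _).trans (by simp)

theorem relStar_of_canonicalRel_diaPow (hL : IsLogic L) {m : ℕ}
    (h : canonicalRel (.diaPow m) x y) : (canonicalFrame L k).relStar x y := by
  induction m generalizing y with
  | zero => exact canonicalRel_id_iff.1 h ▸ .refl
  | succ m ih =>
    obtain ⟨z, hxz, hzy⟩ := (canonicalRel_diaPow_succ_iff hL m).1 h
    exact (ih hxz).tail hzy

theorem canonicalRel_diaLe_of_diaPow_succ (hL : IsLogic L) {m : ℕ} (hm : IsMTransitive L m)
    (h : canonicalRel (.diaPow (m + 1)) x y) : canonicalRel (.diaLe m) x y := fun φ hφ => by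
  have imp_mem := hL.subst (fun _ => φ) _ hm
  rw [Formula.subst_imp, Formula.subst_diaPow, Formula.subst_diaLe] at imp_mem
  exact x.2.mem_of_imp_mem hL ((isDiamond_diaLe hL m).isKFormula (y.2.isKFormula hφ)) imp_mem
    (h φ hφ)

theorem canonicalRel_diaStar_iff (hL : IsLogic L) (hpre : IsPretransitive L) :
    canonicalRel (diaStar L) x y ↔ (canonicalFrame L k).relStar x y := by
  constructor
  · intro h
    obtain ⟨l, -, hl⟩ := (canonicalRel_diaLe_iff hL _).1 h
    exact relStar_of_canonicalRel_diaPow hL hl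
  · intro h
    induction h with
    | refl => exact (canonicalRel_diaLe_iff hL _).2 ⟨0, zero_le, canonicalRel_id_iff.2 rfl⟩
    | tail _ hyz ih =>
      obtain ⟨l, hl, hxy⟩ := (canonicalRel_diaLe_iff hL _).1 ih
      have hxz := (canonicalRel_diaPow_succ_iff hL l).2 ⟨_, hxy, hyz⟩
      rcases hl.lt_or_eq with hlt | rfl
      · exact (canonicalRel_diaLe_iff hL _).2 ⟨l + 1, hlt, hxz⟩
      · exact canonicalRel_diaLe_of_diaPow_succ hL (isMTransitive_transIndex hpre) hxz

end CanonicalRel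

attribute [local instance] KripkeFrame.toPreorder

section CanonicalOrder

variable {φ : Formula n} {x : (canonicalFrame L k).W}

theorem isKFormula_boxStar (hL : IsLogic L) (hφ : φ.IsKFormula k) :
    (boxStar L φ).IsKFormula k :=
  Formula.isKFormula_neg.2 ((isDiamond_diaStar hL).isKFormula (Formula.isKFormula_neg.2 hφ))

theorem diaStar_mem_iff (hL : IsLogic L) (hpre : IsPretransitive L) (hφ : φ.IsKFormula k) :
    diaStar L φ ∈ x.1 ↔ ∃ y ≥ x, φ ∈ y.1 := by
  simp only [(isDiamond_diaStar hL).mem_iff hL hφ, canonicalRel_diaStar_iff hL hpre]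
  rfl

theorem boxStar_mem_iff (hL : IsLogic L) (hpre : IsPretransitive L) (hφ : φ.IsKFormula k) :
    boxStar L φ ∈ x.1 ↔ ∀ y ≥ x, φ ∈ y.1 := by
  have hneg : φ.neg.IsKFormula k := Formula.isKFormula_neg.2 hφ
  change .neg (diaStar L φ.neg) ∈ x.1 ↔ _
  rw [x.2.neg_mem_iff hL ((isDiamond_diaStar hL).isKFormula hneg), diaStar_mem_iff hL hpre hneg]
  push Not
  exact forall₂_congr fun y _ => by rw [y.2.neg_mem_iff hL hφ, not_not]

theorem exists_upperBound_mem (hL : IsLogic L) (hpre : IsPretransitive L) (hφ : φ.IsKFormula k)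
    {c : Set (canonicalFrame L k).W} (hc : DirectedOn (· ≤ ·) c) (hne : c.Nonempty)
    (hφc : ∀ x ∈ c, φ ∈ x.1) : ∃ u, φ ∈ u.1 ∧ ∀ x ∈ c, x ≤ u := by
  have imp_self_mem : .imp φ φ ∈ L := hL.taut _ fun v => by simp
  let I : Set (Formula n) := {ι | ι.IsKFormula k ∧ ∃ x ∈ c, ∀ y ≥ x, ι ∉ y.1}
  have bot_mem : .bot ∈ I :=
    ⟨Formula.isKFormula_bot, hne.imp fun x hx => ⟨hx, fun y _ => y.2.bot_notMem hL⟩⟩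
  have or_mem : ∀ ι ∈ I, ∀ κ ∈ I, .or ι κ ∈ I := by
    rintro ι ⟨hι, x, hx, hιx⟩ κ ⟨hκ, y, hy, hκy⟩
    obtain ⟨z, hz, hxz, hyz⟩ := hc x hx y hy
    refine ⟨Formula.isKFormula_or.2 ⟨hι, hκ⟩, z, hz, fun w hzw hw => ?_⟩
    exact ((w.2.or_mem_iff hL hι hκ).1 hw).elim (hιx w (hxz.trans hzw)) (hκy w (hyz.trans hzw))
  have imp_notMem : ∀ ι ∈ I, .imp φ ι ∉ L := by
    rintro ι ⟨hι, x, hx, hιx⟩ h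
    exact hιx x le_rfl (x.2.mem_of_imp_mem hL hι h (hφc x hx))
  obtain ⟨u, hφu, hu⟩ := exists_canonical_separating hL (Δ := {φ}) (by simpa) (fun _ hι => hι.1)
    (Set.singleton_nonempty φ) (by simpa using imp_self_mem) bot_mem or_mem (by simpa)
  refine ⟨u, hφu rfl, fun x hx => (canonicalRel_diaStar_iff hL hpre).1 fun ψ hψ => ?_⟩
  have hψk := u.2.isKFormula hψ
  by_contra hψx
  rw [diaStar_mem_iff hL hpre hψk] at hψx
  push Not at hψx
  exact hu ψ ⟨hψk, x, hx, hψx⟩ hψ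

theorem exists_maximal_mem (hL : IsLogic L) (hpre : IsPretransitive L) (hφx : φ ∈ x.1) :
    ∃ y ≥ x, Maximal (φ ∈ ·.1) y :=
  zorn_le_nonempty₀ {y : (canonicalFrame L k).W | φ ∈ y.1} (fun c hφc hc z hz => by
    obtain ⟨u, hu, hub⟩ :=
      exists_upperBound_mem hL hpre (x.2.isKFormula hφx) hc.directedOn ⟨z, hz⟩ hφc
    exact ⟨u, hu, hub⟩) x hφx

end CanonicalOrder

section Validity

/-- The formulas valid on `V` under the valuations of the letters by `k`-formulas. -/
def validOn (V : Set (canonicalFrame L k).W) : Set (Formula n) :=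
  {φ | ∀ s : ℕ → Formula n, (∀ p, (s p).IsKFormula k) → ∀ x ∈ V, φ.subst s ∈ x.1}

variable {V : Set (canonicalFrame L k).W} {φ : Formula n}

theorem subset_validOn (hL : IsLogic L) : L ⊆ validOn V := fun φ hφ s hs x _ =>
  x.2.mem_of_mem hL (Formula.IsKFormula.subst s hs φ) (hL.subst s φ hφ)

theorem isLogic_validOn (hL : IsLogic L) (hV : IsUpperSet V) : IsLogic (validOn V) where
  taut φ h := subset_validOn hL (hL.taut φ h)
  dia_or i := subset_validOn hL (hL.dia_or i)
  dia_bot i := subset_validOn hL (hL.dia_bot i)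
  mp φ ψ hφψ hφ s hs x hx := (x.2.imp_mem_iff hL (Formula.IsKFormula.subst s hs φ)
    (Formula.IsKFormula.subst s hs ψ)).1 (hφψ s hs x hx) (hφ s hs x hx)
  subst t φ hφ s hs x hx := by
    rw [Formula.subst_subst]
    exact hφ _ (fun p => Formula.IsKFormula.subst s hs (t p)) x hx
  mono i φ ψ hφψ s hs x hx := by
    have hφ := Formula.IsKFormula.subst s hs φ
    have hψ := Formula.IsKFormula.subst s hs ψ
    refine (x.2.imp_mem_iff hL ((isDiamond_dia hL i).isKFormula hφ)
      ((isDiamond_dia hL i).isKFormula hψ)).2 fun h => ?_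
    obtain ⟨y, hxy, hy⟩ := ((isDiamond_dia hL i).mem_iff hL hφ).1 h
    have hyV : y ∈ V := hV (Relation.ReflTransGen.single ⟨i, hxy⟩) hx
    exact hxy _ ((y.2.imp_mem_iff hL hφ hψ).1 (hφψ s hs y hyV) hy)

theorem mem_of_mem_validOn (hφ : φ.IsKFormula k) (h : φ ∈ validOn V)
    {x : (canonicalFrame L k).W} (hx : x ∈ V) : φ ∈ x.1 := by
  have hs : ∀ p, (if p < k then Formula.var p else .bot : Formula n).IsKFormula k := fun p => by
    split_ifs with hp
    exacts [hp, trivial]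
  simpa [Formula.subst_eq_self hφ (s := fun p => if p < k then .var p else .bot) fun _ hp =>
    if_pos hp] using h _ hs x hx

/-- The points of the `k`-canonical frame of `L` that contain the `k`-formulas of `L'`; for
`L ⊆ L'` these form the `k`-canonical frame of `L'`. -/
def canonicalSubframe (L : Set (Formula n)) (k : ℕ) (L' : Set (Formula n)) :
    Set (canonicalFrame L k).W :=
  {x | ∀ φ ∈ L', φ.IsKFormula k → φ ∈ x.1}

variable {L' : Set (Formula n)}

theorem isUpperSet_canonicalSubframe (hL : IsLogic L) (hpre : IsPretransitive L)
    (hL' : IsLogic L') : IsUpperSet (canonicalSubframe L k L') := fun _ _ hxy hx _ hφ hφk =>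
  (boxStar_mem_iff hL hpre hφk).1
    (hx _ ((isDiamond_diaStar hL').box_mem hL' hφ) (isKFormula_boxStar hL hφk)) _ hxy

theorem subset_validOn_canonicalSubframe (hL' : IsLogic L') :
    L' ⊆ validOn (canonicalSubframe L k L') := fun φ hφ s hs _ hx =>
  hx _ (hL'.subst s φ hφ) (Formula.IsKFormula.subst s hs φ)

theorem mem_iff_forall_mem_canonicalSubframe (hL : IsLogic L) (hL' : IsLogic L') (hLL' : L ⊆ L')
    (hφ : φ.IsKFormula k) : φ ∈ L' ↔ ∀ x ∈ canonicalSubframe L k L', φ ∈ x.1 := by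
  refine ⟨fun h x hx => hx φ h hφ, fun h => ?_⟩
  by_contra hφL'
  obtain ⟨x, hx, hφx⟩ := exists_canonical_separating hL (k := k)
    (Δ := {δ | δ ∈ L' ∧ δ.IsKFormula k}) (I := {ι | .imp ι φ ∈ L' ∧ ι.IsKFormula k})
    (fun _ hδ => hδ.2) (fun _ hι => hι.2)
    ⟨.neg .bot, hL'.taut _ fun v => by simp, Formula.isKFormula_neg.2 trivial⟩
    (fun δ hδ δ' hδ' => ⟨.and δ δ', ⟨hL'.mem_of_eval₂ hδ.1 hδ'.1 fun v => by simp; tauto,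
      Formula.isKFormula_and.2 ⟨hδ.2, hδ'.2⟩⟩, hL.taut _ fun v => by simp; tauto,
      hL.taut _ fun v => by simp⟩)
    ⟨hL'.taut _ fun v => by simp, trivial⟩
    (fun ι hι ι' hι' => ⟨hL'.mem_of_eval₂ hι.1 hι'.1 fun v => by simp; tauto,
      Formula.isKFormula_or.2 ⟨hι.2, hι'.2⟩⟩)
    (fun δ hδ ι hι h => hφL' (hL'.mp _ _ hι.1 (hL'.mp _ _ (hLL' h) hδ.1)))
  exact hφx φ ⟨hL'.taut _ fun v => by simp, hφ⟩ (h x fun ψ hψ hψk => hx ⟨hψ, hψk⟩)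

theorem mem_iff_forall_mem (hL : IsLogic L) (hφ : φ.IsKFormula k) :
    φ ∈ L ↔ ∀ x : (canonicalFrame L k).W, φ ∈ x.1 :=
  (mem_iff_forall_mem_canonicalSubframe hL hL subset_rfl hφ).trans
    ⟨fun h x => h x fun _ hψ hψk => x.2.mem_of_mem hL hψk hψ, fun h x _ => h x⟩

end Validity

section Height

theorem subset_extendBy (L Ψ : Set (Formula n)) : L ∪ Ψ ⊆ extendBy L Ψ :=
  fun _ hφ _ hL' => hL'.2 hφ

theorem isLogic_ofHeight (L : Set (Formula n)) (h : ℕ) : IsLogic (ofHeight L h) :=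
  isLogic_extendBy _ _

theorem subset_ofHeight (L : Set (Formula n)) (h : ℕ) : L ⊆ ofHeight L h :=
  fun _ hφ => subset_extendBy _ _ (.inl hφ)

theorem heightFormula_mem_ofHeight (L : Set (Formula n)) (h : ℕ) :
    heightFormula L h ∈ ofHeight L h :=
  subset_extendBy _ _ (.inr rfl)

theorem isKFormula_heightFormula (hL : IsLogic L) (i : ℕ) :
    (heightFormula L i).IsKFormula (i + 1) := by
  induction i with
  | zero => trivial
  | succ i ih =>
    have hvar : (Formula.var (i + 1) : Formula n).IsKFormula (i + 2) := Nat.lt_succ_self _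
    exact ⟨hvar, isKFormula_boxStar hL (Formula.isKFormula_or.2
      ⟨(isDiamond_diaStar hL).isKFormula hvar, ih.mono (Nat.le_succ _)⟩)⟩

theorem subst_heightFormula_succ (s : ℕ → Formula n) (i : ℕ) :
    (heightFormula L (i + 1)).subst s = .imp (s (i + 1))
      (boxStar L (.or (diaStar L (s (i + 1))) ((heightFormula L i).subst s))) := by
  simp only [heightFormula, boxStar, diaStar, Formula.subst_imp, Formula.subst_boxLe,
    Formula.subst_or, Formula.subst_diaLe, Formula.subst]

variable {x : (canonicalFrame L k).W}

theorem subst_heightFormula_succ_mem_iff (hL : IsLogic L) (hpre : IsPretransitive L)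
    {s : ℕ → Formula n} (hs : ∀ p, (s p).IsKFormula k) (i : ℕ) :
    (heightFormula L (i + 1)).subst s ∈ x.1 ↔
      (s (i + 1) ∈ x.1 → ∀ y ≥ x,
        (∃ z ≥ y, s (i + 1) ∈ z.1) ∨ (heightFormula L i).subst s ∈ y.1) := by
  have hdia := (isDiamond_diaStar (L := L) hL).isKFormula (hs (i + 1))
  have hB := Formula.IsKFormula.subst s hs (heightFormula L i)
  have hor := Formula.isKFormula_or.2 ⟨hdia, hB⟩
  rw [subst_heightFormula_succ, x.2.imp_mem_iff hL (hs _) (isKFormula_boxStar hL hor),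
    boxStar_mem_iff hL hpre hor]
  refine imp_congr_right fun _ => forall₂_congr fun y _ => ?_
  rw [y.2.or_mem_iff hL hdia hB, diaStar_mem_iff hL hpre (hs _)]

theorem subst_heightFormula_mem (hL : IsLogic L) (hpre : IsPretransitive L)
    {s : ℕ → Formula n} (hs : ∀ p, (s p).IsKFormula k) {i : ℕ} (hx : Order.coheight x < i) :
    (heightFormula L i).subst s ∈ x.1 := by
  induction i generalizing x with
  | zero => simp at hx
  | succ i ih =>
    refine (subst_heightFormula_succ_mem_iff hL hpre hs i).2 fun hsx y hxy => ?_
    by_cases hyx : y ≤ x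
    · exact .inl ⟨x, hyx, hsx⟩
    · exact .inr (ih ((coheight_lt_succ_iff i x).1 hx y (lt_of_le_not_ge hxy hyx)))

/-- A chain `x < y < …` refutes `B_{i+1}` at `x`: a formula in `x` whose `◇*` is not in `y` exists
because `◇*` defines the order, and it may be substituted for the last letter of `B_{i+1}`. -/
theorem exists_subst_heightFormula_notMem (hL : IsLogic L) (hpre : IsPretransitive L) {i : ℕ}
    (hx : ¬ Order.coheight x < i) :
    ∃ s : ℕ → Formula n, (∀ p, (s p).IsKFormula k) ∧ (heightFormula L i).subst s ∉ x.1 := by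
  induction i generalizing x with
  | zero => exact ⟨fun _ => .bot, fun _ => trivial, x.2.bot_notMem hL⟩
  | succ i ih =>
    rw [coheight_lt_succ_iff] at hx
    push Not at hx
    obtain ⟨y, hxy, hy⟩ := hx
    obtain ⟨s, hs, hsy⟩ := ih hy.not_gt
    obtain ⟨φ, hφx, hφy⟩ : ∃ φ ∈ x.1, diaStar L φ ∉ y.1 := by
      simpa [canonicalRel] using mt (canonicalRel_diaStar_iff hL hpre).1 hxy.not_ge
    have hφk := x.2.isKFormula hφx
    have ht : ∀ p, (Function.update s (i + 1) φ p).IsKFormula k := fun p => by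
      rcases eq_or_ne p (i + 1) with rfl | hp
      · simpa
      · simpa [hp] using hs p
    refine ⟨Function.update s (i + 1) φ, ht, fun hB => ?_⟩
    rw [subst_heightFormula_succ_mem_iff hL hpre ht, Function.update_self,
      (isKFormula_heightFormula hL i).subst_congr (t := s) fun p hp =>
        Function.update_of_ne hp.ne _ _] at hB
    rcases hB hφx y hxy.le with h | h
    exacts [hφy ((diaStar_mem_iff hL hpre hφk).2 h), hsy h]

theorem canonicalSubframe_ofHeight (hL : IsLogic L) (hpre : IsPretransitive L) (i : ℕ) :
    canonicalSubframe L k (ofHeight L i) = {x | Order.coheight x < i} := by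
  ext x
  constructor
  · intro hx
    by_contra hxi
    obtain ⟨s, hs, hsx⟩ := exists_subst_heightFormula_notMem hL hpre hxi
    exact hsx (subset_validOn_canonicalSubframe (isLogic_ofHeight L i)
      (heightFormula_mem_ofHeight L i) s hs x hx)
  · intro hx φ hφ hφk
    have hV : IsUpperSet {x : (canonicalFrame L k).W | Order.coheight x < i} :=
      fun _ _ hxy hx => (Order.coheight_anti hxy).trans_lt hx
    refine mem_of_mem_validOn hφk (hφ _ ⟨isLogic_validOn hL hV, Set.union_subset
      (subset_validOn hL) (Set.singleton_subset_iff.2 ?_)⟩) hx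
    exact fun s hs x hx => subst_heightFormula_mem hL hpre hs hx

end Height

section Definability

/-- `P` is the set of points of the `k`-canonical frame of `L` that contain some `k`-formula. -/
def IsDefinable (P : Set (canonicalFrame L k).W) : Prop :=
  ∃ β : Formula n, β.IsKFormula k ∧ ∀ x, β ∈ x.1 ↔ x ∈ P

variable {P Q : Set (canonicalFrame L k).W}

theorem isDefinable_setOf_mem {φ : Formula n} (hφ : φ.IsKFormula k) :
    IsDefinable {x : (canonicalFrame L k).W | φ ∈ x.1} :=
  ⟨φ, hφ, fun _ => Iff.rfl⟩

theorem IsDefinable.compl (hL : IsLogic L) (hP : IsDefinable P) : IsDefinable Pᶜ := by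
  obtain ⟨β, hβ, hβP⟩ := hP
  exact ⟨.neg β, by simpa, fun x => (x.2.neg_mem_iff hL hβ).trans (not_congr (hβP x))⟩

theorem IsDefinable.inter (hL : IsLogic L) (hP : IsDefinable P) (hQ : IsDefinable Q) :
    IsDefinable (P ∩ Q) := by
  obtain ⟨β, hβ, hβP⟩ := hP
  obtain ⟨γ, hγ, hγQ⟩ := hQ
  exact ⟨.and β γ, Formula.isKFormula_and.2 ⟨hβ, hγ⟩, fun x =>
    (x.2.and_mem_iff hL hβ hγ).trans (and_congr (hβP x) (hγQ x))⟩

theorem isDefinable_univ (hL : IsLogic L) :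
    IsDefinable (Set.univ : Set (canonicalFrame L k).W) :=
  ⟨.neg .bot, by simp, fun x => iff_of_true
    (x.2.mem_of_mem hL (by simp) (hL.taut _ fun v => by simp)) trivial⟩

variable {ι : Type*} {s : Set ι} {f : ι → Set (canonicalFrame L k).W}

theorem isDefinable_biInter (hL : IsLogic L) (hs : s.Finite) (hf : ∀ i ∈ s, IsDefinable (f i)) :
    IsDefinable (⋂ i ∈ s, f i) := by
  induction s, hs using Set.Finite.induction_on with
  | empty => simpa using isDefinable_univ hL
  | insert _ _ ih =>
    rw [Set.biInter_insert]
    exact (hf _ (Set.mem_insert _ _)).inter hL (ih fun i hi => hf i (Set.mem_insert_of_mem _ hi))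

theorem isDefinable_biUnion (hL : IsLogic L) (hs : s.Finite) (hf : ∀ i ∈ s, IsDefinable (f i)) :
    IsDefinable (⋃ i ∈ s, f i) := by
  simpa only [Set.compl_iInter, compl_compl] using
    (isDefinable_biInter hL hs fun i hi => (hf i hi).compl hL).compl hL

end Definability

section Tabular

/-- The `k`-formulas obtained by applying a single formation rule to members of `S`. -/
def oneStepFormulas (k : ℕ) (S : Set (Formula n)) : Set (Formula n) :=
  Formula.var '' Set.Iio k ∪ {.bot} ∪ Set.image2 .imp S S ∪ Set.image2 .dia Set.univ S

variable {S L' : Set (Formula n)} {φ : Formula n}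

theorem finite_oneStepFormulas (hS : S.Finite) : (oneStepFormulas k S).Finite :=
  ((((Set.finite_Iio k).image _).union (Set.finite_singleton _)).union (hS.image2 _ hS)).union
    (Set.finite_univ.image2 _ hS)

theorem isKFormula_of_mem_oneStepFormulas (hS : ∀ ψ ∈ S, ψ.IsKFormula k)
    (hφ : φ ∈ oneStepFormulas k S) : φ.IsKFormula k := by
  rcases hφ with ((⟨p, hp, rfl⟩ | rfl) | ⟨φ, hφ, ψ, hψ, rfl⟩) | ⟨i, -, φ, hφ, rfl⟩
  exacts [hp, trivial, ⟨hS φ hφ, hS ψ hψ⟩, hS φ hφ]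

/-- Equivalences of `L'` between one-step formulas and members of `S`. If `S` represents all
`k`-formulas up to equivalence in `L'`, these finitely many formulas axiomatize the `k`-formulas
of `L'` over `L`. -/
def oneStepEquivs (L' : Set (Formula n)) (k : ℕ) (S : Set (Formula n)) : Set (Formula n) :=
  L' ∩ Set.image2 .iff (oneStepFormulas k S) S

theorem finite_oneStepEquivs (hS : S.Finite) : (oneStepEquivs L' k S).Finite :=
  ((finite_oneStepFormulas hS).image2 _ hS).inter_of_right _

theorem isKFormula_of_mem_oneStepEquivs (hS : ∀ ψ ∈ S, ψ.IsKFormula k)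
    (hφ : φ ∈ oneStepEquivs L' k S) : φ.IsKFormula k := by
  obtain ⟨-, ψ, hψ, χ, hχ, rfl⟩ := hφ
  exact Formula.isKFormula_iff.2 ⟨isKFormula_of_mem_oneStepFormulas hS hψ, hS χ hχ⟩

variable {x : (canonicalFrame L k).W}

theorem exists_iff_mem_of_oneStepEquivs_subset (hL : IsLogic L) (hL' : IsLogic L')
    (hS : ∀ ψ ∈ S, ψ.IsKFormula k) (hSL' : ∀ φ, φ.IsKFormula k → ∃ ψ ∈ S, .iff φ ψ ∈ L')
    (hx : ∀ y ≥ x, oneStepEquivs L' k S ⊆ y.1) (hφ : φ.IsKFormula k) :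
    ∃ ψ ∈ S, .iff φ ψ ∈ L' ∧ ∀ y ≥ x, (φ ∈ y.1 ↔ ψ ∈ y.1) := by
  have of_oneStep : ∀ χ ∈ oneStepFormulas k S,
      ∃ ψ ∈ S, .iff χ ψ ∈ L' ∧ ∀ y ≥ x, (χ ∈ y.1 ↔ ψ ∈ y.1) := fun χ hχ => by
    have hχk := isKFormula_of_mem_oneStepFormulas hS hχ
    obtain ⟨ψ, hψ, h⟩ := hSL' χ hχk
    exact ⟨ψ, hψ, h, fun y hy => (y.2.iff_mem_iff hL hχk (hS ψ hψ)).1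
      (hx y hy ⟨h, Set.mem_image2_of_mem hχ hψ⟩)⟩
  induction φ with
  | var p => exact of_oneStep _ (.inl (.inl (.inl (Set.mem_image_of_mem _ hφ))))
  | bot => exact of_oneStep _ (.inl (.inl (.inr rfl)))
  | imp φ ψ ihφ ihψ =>
    obtain ⟨φ', hφ', hφφ', hxφ⟩ := ihφ hφ.1
    obtain ⟨ψ', hψ', hψψ', hxψ⟩ := ihψ hφ.2
    obtain ⟨χ, hχ, h, hxχ⟩ := of_oneStep _ (.inl (.inr (Set.mem_image2_of_mem hφ' hψ')))
    have hequiv : .iff (.imp φ ψ) (.imp φ' ψ') ∈ L' :=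
      hL'.mem_of_eval₂ hφφ' hψψ' fun v => by simp; tauto
    refine ⟨χ, hχ, hL'.mem_of_eval₂ hequiv h fun v => by simp; tauto, fun y hy => ?_⟩
    rw [← hxχ y hy, y.2.imp_mem_iff hL hφ.1 hφ.2,
      y.2.imp_mem_iff hL (hS φ' hφ') (hS ψ' hψ'), hxφ y hy, hxψ y hy]
  | dia i φ ih =>
    have hφk : φ.IsKFormula k := hφ
    obtain ⟨φ', hφ', hφφ', hxφ⟩ := ih hφk
    obtain ⟨χ, hχ, h, hxχ⟩ := of_oneStep _ (.inr (Set.mem_image2_of_mem (Set.mem_univ i) hφ'))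
    have hequiv : .iff (.dia i φ) (.dia i φ') ∈ L' := (isDiamond_dia hL' i).iff_mem hL' hφφ'
    refine ⟨χ, hχ, hL'.mem_of_eval₂ hequiv h fun v => by simp; tauto, fun y hy => ?_⟩
    rw [← hxχ y hy, (isDiamond_dia hL i).mem_iff hL hφk,
      (isDiamond_dia hL i).mem_iff hL (hS φ' hφ')]
    exact exists_congr fun z => and_congr_right fun hyz =>
      hxφ z (hy.trans (Relation.ReflTransGen.single ⟨i, hyz⟩))

theorem mem_canonicalSubframe_iff_oneStepEquivs_subset (hL : IsLogic L) (hpre : IsPretransitive L)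
    (hL' : IsLogic L') (hS : ∀ ψ ∈ S, ψ.IsKFormula k)
    (hSL' : ∀ φ, φ.IsKFormula k → ∃ ψ ∈ S, .iff φ ψ ∈ L') :
    x ∈ canonicalSubframe L k L' ↔ ∀ y ≥ x, oneStepEquivs L' k S ⊆ y.1 := by
  constructor
  · intro hx y hxy α hα
    exact isUpperSet_canonicalSubframe hL hpre hL' hxy hx α hα.1
      (isKFormula_of_mem_oneStepEquivs hS hα)
  · intro hx φ hφ hφk
    obtain ⟨ψ, hψ, hφψ, hxφ⟩ := exists_iff_mem_of_oneStepEquivs_subset hL hL' hS hSL' hx hφk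
    have hψk := hS ψ hψ
    have hψL' : .iff (.imp ψ ψ) ψ ∈ L' := hL'.mem_of_eval₂ hφ hφψ fun v => by simp; tauto
    have hψx : .iff (.imp ψ ψ) ψ ∈ x.1 := hx x le_rfl
      ⟨hψL', Set.mem_image2_of_mem (.inl (.inr (Set.mem_image2_of_mem hψ hψ))) hψ⟩
    rw [x.2.iff_mem_iff hL (Formula.isKFormula_imp.2 ⟨hψk, hψk⟩) hψk,
      x.2.imp_mem_iff hL hψk hψk] at hψx
    exact (hxφ x le_rfl).2 (hψx.1 id)

theorem isDefinable_canonicalSubframe (hL : IsLogic L) (hpre : IsPretransitive L)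
    (hL' : IsLogic L') (htab : IsKTabular L' k) : IsDefinable (canonicalSubframe L k L') := by
  obtain ⟨S, hfin, hS, hSL'⟩ := htab
  have hinter : canonicalSubframe L k L' =
      ⋂ α ∈ oneStepEquivs L' k S, {x | boxStar L α ∈ x.1} := by
    ext x
    have boxStar_mem_iff (α) (hα : α ∈ oneStepEquivs L' k S) :
        boxStar L α ∈ x.1 ↔ ∀ y ≥ x, α ∈ y.1 :=
      boxStar_mem_iff hL hpre (isKFormula_of_mem_oneStepEquivs hS hα)
    rw [mem_canonicalSubframe_iff_oneStepEquivs_subset hL hpre hL' hS hSL', Set.mem_iInter₂]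
    exact ⟨fun h α hα => (boxStar_mem_iff α hα).2 fun y hy => h y hy hα,
      fun h y hy α hα => (boxStar_mem_iff α hα).1 (h α hα) y hy⟩
  rw [hinter]
  exact isDefinable_biInter hL (finite_oneStepEquivs hfin) fun α hα =>
    isDefinable_setOf_mem (isKFormula_boxStar hL (isKFormula_of_mem_oneStepEquivs hS hα))

theorem eq_of_forall_mem_iff_mem (hL : IsLogic L) (hS : ∀ ψ ∈ S, ψ.IsKFormula k)
    (hSL' : ∀ φ, φ.IsKFormula k → ∃ ψ ∈ S, .iff φ ψ ∈ L') {y : (canonicalFrame L k).W}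
    (hx : x ∈ canonicalSubframe L k L') (hy : y ∈ canonicalSubframe L k L')
    (hxy : ∀ ψ ∈ S, (ψ ∈ y.1 ↔ ψ ∈ x.1)) : y = x := by
  have exists_mem_iff {φ : Formula n} (hφ : φ.IsKFormula k) :
      ∃ ψ ∈ S, ∀ z ∈ canonicalSubframe L k L', (φ ∈ z.1 ↔ ψ ∈ z.1) := by
    obtain ⟨ψ, hψ, h⟩ := hSL' φ hφ
    exact ⟨ψ, hψ, fun z hz => (z.2.iff_mem_iff hL hφ (hS ψ hψ)).1
      (hz _ h (Formula.isKFormula_iff.2 ⟨hφ, hS ψ hψ⟩))⟩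
  refine canonicalRel_id_iff.1 fun φ hφ => ?_
  obtain ⟨ψ, hψ, h⟩ := exists_mem_iff (x.2.isKFormula hφ)
  exact (h y hy).2 ((hxy ψ hψ).2 ((h x hx).1 hφ))

theorem finite_canonicalSubframe (hL : IsLogic L) (htab : IsKTabular L' k) :
    (canonicalSubframe L k L').Finite := by
  obtain ⟨S, hfin, hS, hSL'⟩ := htab
  refine Set.Finite.of_injOn (f := fun x => S ∩ x.1) (fun _ _ => Set.inter_subset_left)
    (fun y hy x hx hyx => ?_) hfin.finite_subsets
  exact eq_of_forall_mem_iff_mem hL hS hSL' hx hy fun ψ hψ => by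
    simpa [hψ] using Set.ext_iff.1 hyx ψ

theorem isDefinable_singleton (hL : IsLogic L) (hpre : IsPretransitive L) (hL' : IsLogic L')
    (htab : IsKTabular L' k) (hx : x ∈ canonicalSubframe L k L') : IsDefinable {x} := by
  have hdef := isDefinable_canonicalSubframe hL hpre hL' htab
  obtain ⟨S, hfin, hS, hSL'⟩ := htab
  have hinter : {x} =
      canonicalSubframe L k L' ∩ ⋂ ψ ∈ S, {y | ψ ∈ y.1 ↔ ψ ∈ x.1} := by
    ext y
    simp only [Set.mem_singleton_iff, Set.mem_inter_iff, Set.mem_iInter₂, Set.mem_ofPred_eq]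
    exact ⟨by rintro rfl; exact ⟨hx, fun _ _ => Iff.rfl⟩, fun h =>
      eq_of_forall_mem_iff_mem hL hS hSL' hx h.1 h.2⟩
  rw [hinter]
  refine hdef.inter hL (isDefinable_biInter hL hfin fun ψ hψ => ?_)
  by_cases hψx : ψ ∈ x.1
  · simpa only [hψx, iff_true] using isDefinable_setOf_mem (hS ψ hψ)
  · simp only [hψx, iff_false]
    exact (isDefinable_setOf_mem (hS ψ hψ)).compl hL

theorem isDefinable_of_subset_canonicalSubframe (hL : IsLogic L) (hpre : IsPretransitive L)
    (hL' : IsLogic L') (htab : IsKTabular L' k) {P : Set (canonicalFrame L k).W}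
    (hP : P ⊆ canonicalSubframe L k L') : IsDefinable P := by
  rw [← Set.biUnion_of_singleton P]
  exact isDefinable_biUnion hL ((finite_canonicalSubframe hL htab).subset hP) fun x hx =>
    isDefinable_singleton hL hpre hL' htab (hP hx)

end Tabular

section Translation

variable {h : ℕ} {B : ℕ → Formula n} {φ : Formula n}

theorem exists_definesDepth (hL : IsLogic L) (hpre : IsPretransitive L)
    (htab : IsKTabular (ofHeight L h) k) : ∃ B : ℕ → Formula n, DefinesDepth L h k B := by
  have exists_formula : ∀ i ≤ h, ∃ β : Formula n, β.IsKFormula k ∧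
      ∀ x : (canonicalFrame L k).W, β ∈ x.1 ↔ (canonicalFrame L k).depth x ≤ (i : ℕ∞) := by
    intro i hi
    simp only [KripkeFrame.depth_le_iff_coheight_lt]
    refine isDefinable_of_subset_canonicalSubframe hL hpre (isLogic_ofHeight L h) htab
      (P := {x | Order.coheight x < i}) ?_
    rw [canonicalSubframe_ofHeight hL hpre]
    exact Set.ofPred_subset_ofPred.2 fun x hx => hx.trans_le (Nat.cast_le.2 hi)
  have : Nonempty (Formula n) := ⟨.bot⟩
  choose! B hB using exists_formula
  exact ⟨B, hB⟩

theorem isKFormula_translation (hL : IsLogic L) (hB : DefinesDepth L h k B)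
    (hφ : φ.IsKFormula k) : (translation L h B φ).IsKFormula k := by
  simp only [translation, Formula.isKFormula_bigAnd, List.forall_mem_map, List.mem_range,
    Nat.lt_succ_iff]
  exact fun i hi => ⟨isKFormula_boxStar hL ⟨isKFormula_boxStar hL hφ, (hB i hi).1⟩, (hB i hi).1⟩

theorem translation_mem_iff (hL : IsLogic L) (hpre : IsPretransitive L)
    (hB : DefinesDepth L h k B) (hφ : φ.IsKFormula k) {x : (canonicalFrame L k).W} :
    translation L h B φ ∈ x.1 ↔
      ∀ i ≤ h, (∀ y ≥ x, (∀ z ≥ y, φ ∈ z.1) → Order.coheight y < i) → Order.coheight x < i := by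
  have hk := isKFormula_translation hL hB hφ
  rw [translation, Formula.isKFormula_bigAnd] at hk
  rw [translation, x.2.bigAnd_mem_iff hL hk]
  simp only [List.forall_mem_map, List.mem_range, Nat.lt_succ_iff]
  refine forall₂_congr fun i hi => ?_
  obtain ⟨hBk, hBi⟩ := hB i hi
  simp only [KripkeFrame.depth_le_iff_coheight_lt] at hBi
  have hφk := isKFormula_boxStar hL hφ
  have hφB : (Formula.imp (boxStar L φ) (B i)).IsKFormula k := ⟨hφk, hBk⟩
  rw [x.2.imp_mem_iff hL (isKFormula_boxStar hL hφB) hBk, boxStar_mem_iff hL hpre hφB, hBi]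
  refine imp_congr_left (forall₂_congr fun y _ => ?_)
  rw [y.2.imp_mem_iff hL hφk hBk, boxStar_mem_iff hL hpre hφ, hBi]

theorem mem_ofHeight_succ_iff_translation_mem (hL : IsLogic L) (hpre : IsPretransitive L)
    (hB : DefinesDepth L h k B) (hφ : φ.IsKFormula k) :
    φ ∈ ofHeight L (h + 1) ↔ translation L h B φ ∈ L := by
  have exists_maximal : ∀ i ≤ h, ∀ x : (canonicalFrame L k).W, ¬ Order.coheight x < i →
      ∃ y ≥ x, Maximal (fun z => ¬ Order.coheight z < i) y := by
    intro i hi x hx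
    have neg_mem_iff (y : (canonicalFrame L k).W) :
        .neg (B i) ∈ y.1 ↔ ¬ Order.coheight y < i := by
      rw [y.2.neg_mem_iff hL (hB i hi).1, (hB i hi).2, KripkeFrame.depth_le_iff_coheight_lt]
    simpa only [neg_mem_iff] using exists_maximal_mem hL hpre ((neg_mem_iff x).2 hx)
  rw [mem_iff_forall_mem_canonicalSubframe hL (isLogic_ofHeight L _) (subset_ofHeight L _) hφ,
    canonicalSubframe_ofHeight hL hpre, mem_iff_forall_mem hL (isKFormula_translation hL hB hφ)]
  simp only [translation_mem_iff hL hpre hB hφ]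
  exact (forall_coheight_lt_succ_iff (V := {x | φ ∈ x.1}) exists_maximal).trans
    ⟨fun H x i hi => H i hi x, fun H i hi x => H x i hi⟩

end Translation

end ModalLogic

theorem mainTheorem1 {n : ℕ} (hn : 0 < n) (L : Set (Formula n)) (hL : IsLogic L)
    (hpre : ModalLogic.IsPretransitive L) (h k : ℕ)
    (htab : ModalLogic.IsKTabular (ModalLogic.ofHeight L h) k) :
    (∃ B : ℕ → Formula n, ModalLogic.DefinesDepth L h k B) ∧
    ∀ B : ℕ → Formula n, ModalLogic.DefinesDepth L h k B →
      ∀ φ : Formula n, φ.IsKFormula k →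
        (φ ∈ ModalLogic.ofHeight L (h + 1) ↔ ModalLogic.translation L h B φ ∈ L) :=
  ⟨ModalLogic.exists_definesDepth hL hpre htab, fun _ hB _ hφ =>
    ModalLogic.mem_ofHeight_succ_iff_translation_mem hL hpre hB hφ⟩
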